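/- Let $n\ge 1$ and let $(M,\omega)$ be a pre-$n$-plectic manifold, i.e. a smooth manifold $M$ with a closed form $\omega\in\Omega^{n+1}(M)$. Write $\iota$ for the interior product and $\mathcal L_v=d\iota_v+\iota_v d$ for the Lie derivative. A vector field $v_\alpha$ is a Hamiltonian vector field of $\alpha\in\Omega^{n-1}(M)$ if $d\alpha=-\iota_{v_\alpha}\omega$, and $\alpha$ is Hamiltonian if it has a Hamiltonian vector field. Let $\mathfrak g$ be a real Lie algebra and $\partial_k\colon\Lambda^k\mathfrak g\to\Lambda^{k-1}\mathfrak g$ the linear map with $$\partial_k(x_1\wedge\dots\wedge x_k)=\sum_{1\le i<j\le k}(-1)^{i+j}[x_i,x_j]\wedge x_1\wedge\dots\wedge\hat x_i\wedge\dots\wedge\hat x_j\wedge\dots\wedge x_k ,$$ and let $B_k(\mathfrak g)=\operatorname{im}(\partial_{k+1})\subset\Lambda^k\mathfrak g$. Let $\mathfrak g\to\mathfrak X(M)$, $x\mapsto v_x$, be a Lie algebra homomorphism with $\mathcal L_{v_x}\omega=0$ for all $x\in\mathfrak g$. For $p=x_1\wedge\dots\wedge x_k$ put $\iota(v_p)=\iota_{v_{x_k}}\cdots\iota_{v_{x_1}}$,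 extended linearly to $p\in\Lambda^k\mathfrak g$, and let $\varsigma(k)=-(-1)^{k(k+1)/2}$. Let $(f)$ be a homotopy co-momentum map for this action: linear maps $f_k\colon\Lambda^k\mathfrak g\to\Omega^{n-k}(M)$, $1\le k\le n$, such that every $f_1(x)$ is Hamiltonian, $d f_1(x)=-\iota_{v_x}\omega$ for all $x\in\mathfrak g$, and, with $f_0=0$ and $f_{n+1}=0$, $$-f_{k-1}(\partial_k p)=d f_k(p)+\varsigma(k)\,\iota(v_p)\omega\qquad\text{for all }1\le k\le n+1,\ p\in\Lambda^k\mathfrak g .$$ Let $H\in\Omega^{n-1}(M)$ be a Hamiltonian form, and suppose that the action is locally $H$-preserving, i.e. $\mathcal L_{v_x}H$ is closed for all $x\in\mathfrak g$. Then for every $1\le k\le n$, every $p\in B_k(\mathfrak g)$ and every Hamiltonian vector field $v_H$ of $H$, the form $f_k(p)$ is globally conserved by $v_H$, i.e. $\mathcal L_{v_H}f_k(p)$ is exact (where an exact $0$-form means the zero function). -/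

import Mathlib

open scoped Manifold ContDiff

noncomputable section

namespace Multisymplectic

section Contraction

variable {V : Type*} [NormedAddCommGroup V] [NormedSpace ℝ V] {l : ℕ}

/-- The iterated contraction `ι_{u_k} ⋯ ι_{u_1} α` of an alternating form `α` with vectors `u_i`. -/
def iterContract :
    {k : ℕ} → (V [⋀^Fin (l + k)]→L[ℝ] ℝ) → (Fin k → V) → V [⋀^Fin l]→L[ℝ] ℝ
  | 0, α, _ => α
  | _ + 1, α, u => iterContract (α.curryLeft (u 0)) (Fin.tail u)

theorem iterContract_apply {k : ℕ} (α : V [⋀^Fin (l + k)]→L[ℝ] ℝ) (u : Fin k → V)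
    (w : Fin l → V) :
    iterContract α u w = α (fun i ↦ Fin.append u w (Fin.cast (Nat.add_comm l k) i)) := by
  induction k with
  | zero =>
    simp only [iterContract]
    congr 1
    ext i
    have : Fin.cast (Nat.add_comm l 0) i = Fin.natAdd 0 i := by ext; simp
    rw [this, Fin.append_right]
  | succ k ih =>
    simp only [iterContract]
    rw [ih, ContinuousAlternatingMap.curryLeft_apply_apply]
    refine congrArg α ?_
    funext i
    refine Fin.cases ?_ (fun i ↦ ?_) i
    · have : Fin.cast (Nat.add_comm l (k + 1)) (0 : Fin (l + k + 1)) = Fin.castAdd l 0 := by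
        ext; simp
      rw [this, Fin.append_left]
      rfl
    · rw [Matrix.cons_val_succ]
      rcases lt_or_ge (i : ℕ) k with h | h
      · have h1 : Fin.cast (Nat.add_comm l k) i = Fin.castAdd l ⟨i, h⟩ := by ext; simp
        have h2 : Fin.cast (Nat.add_comm l (k + 1)) i.succ =
            Fin.castAdd l (⟨i + 1, by omega⟩ : Fin (k + 1)) := by ext; simp
        rw [h1, h2, Fin.append_left, Fin.append_left]
        rfl
      · have hi : (i : ℕ) < l + k := i.2
        have h1 : Fin.cast (Nat.add_comm l k) i =
            Fin.natAdd k (⟨i - k, by omega⟩ : Fin l) := by ext; simp; omega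
        have h2 : Fin.cast (Nat.add_comm l (k + 1)) i.succ =
            Fin.natAdd (k + 1) (⟨i - k, by omega⟩ : Fin l) := by ext; simp; omega
        rw [h1, h2, Fin.append_right, Fin.append_right]

theorem append_update_cast {V : Type*} {k l : ℕ} (u : Fin k → V) (w : Fin l → V) (i : Fin k) (a : V) :
    (fun j : Fin (l + k) ↦
      Fin.append (Function.update u i a) w (Fin.cast (Nat.add_comm l k) j)) =
    Function.update (fun j ↦ Fin.append u w (Fin.cast (Nat.add_comm l k) j))
      (Fin.cast (Nat.add_comm k l) (Fin.castAdd l i)) a := by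
  funext j
  obtain ⟨j, rfl⟩ : ∃ j', Fin.cast (Nat.add_comm k l) j' = j :=
    ⟨Fin.cast (Nat.add_comm l k) j, by simp⟩
  simp only [Fin.cast_cast, Fin.cast_eq_self, Function.update_apply, Fin.cast_inj]
  refine Fin.addCases (fun j ↦ ?_) (fun j ↦ ?_) j
  · simp [Function.update_apply]
  · have : Fin.natAdd k j ≠ Fin.castAdd l i := by
      intro h
      have := congrArg Fin.val h
      simp at this
      omega
    simp [this]

/-- The iterated contraction is alternating in the vectors. -/
def contractAlt {k : ℕ} (α : V [⋀^Fin (l + k)]→L[ℝ] ℝ) :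
    V [⋀^Fin k]→ₗ[ℝ] (V [⋀^Fin l]→L[ℝ] ℝ) where
  toFun u := iterContract α u
  map_update_add' u i a b := by
    obtain rfl := Subsingleton.elim ‹DecidableEq (Fin k)› (instDecidableEqFin k)
    ext w
    simp only [iterContract_apply, append_update_cast, ContinuousAlternatingMap.add_apply,
      ContinuousAlternatingMap.map_update_add]
  map_update_smul' u i c a := by
    obtain rfl := Subsingleton.elim ‹DecidableEq (Fin k)› (instDecidableEqFin k)
    ext w
    simp only [iterContract_apply, append_update_cast, ContinuousAlternatingMap.smul_apply,
      ContinuousAlternatingMap.map_update_smul]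
  map_eq_zero_of_eq' u i j h hij := by
    ext w
    rw [iterContract_apply]
    refine α.map_eq_zero_of_eq _ (i := Fin.cast (Nat.add_comm k l) (Fin.castAdd l i))
      (j := Fin.cast (Nat.add_comm k l) (Fin.castAdd l j)) ?_ ?_
    · simpa using h
    · simpa using hij

/-- The contraction `ι(P) α` with a multivector `P ∈ Λ^k V`; on `P = u_1 ∧ ⋯ ∧ u_k` it is
`ι_{u_k} ⋯ ι_{u_1} α`. -/
def contract {k : ℕ} (α : V [⋀^Fin (l + k)]→L[ℝ] ℝ) :
    ⋀[ℝ]^k V →ₗ[ℝ] (V [⋀^Fin l]→L[ℝ] ℝ) :=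
  exteriorPower.alternatingMapLinearEquiv (contractAlt α)

end Contraction

section Homology

variable (𝔤 : Type*) [LieRing 𝔤] [LieAlgebra ℝ 𝔤]

/-- The trilinear expression `[x, y] ∧ z_1 ∧ ⋯ ∧ z_k`. -/
def bracketWedge (k : ℕ) : 𝔤 →ₗ[ℝ] 𝔤 →ₗ[ℝ] 𝔤 [⋀^Fin k]→ₗ[ℝ] ⋀[ℝ]^(k + 1) 𝔤 :=
  (LieModule.toEnd ℝ 𝔤 𝔤 : 𝔤 →ₗ[ℝ] 𝔤 →ₗ[ℝ] 𝔤).compr₂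
    (exteriorPower.ιMulti ℝ (k + 1) (M := 𝔤)).curryLeft

/-- The right-hand side of the formula defining the Lie algebra homology differential on
`x_0 ∧ ⋯ ∧ x_{k+1}`:
`∑_{a < b} (-1)^{a+b} [x_a, x_b] ∧ x_0 ∧ ⋯ x̂_a ⋯ x̂_b ⋯ ∧ x_{k+1}`.
Pairs `a < b` are written as `a = i.castSucc`, `b = j.succ` with `i ≤ j`. Numbering from `0` instead of
`1` does not change the sign. -/
def lieBoundaryFormula (k : ℕ) (x : Fin (k + 2) → 𝔤) : ⋀[ℝ]^(k + 1) 𝔤 :=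
  ∑ i : Fin (k + 1), ∑ j ≥ i,
    (-1 : ℝ) ^ ((i.castSucc : ℕ) + (j.succ : ℕ)) •
      exteriorPower.ιMulti ℝ (k + 1)
        (Matrix.vecCons ⁅x i.castSucc, x j.succ⁆ (j.removeNth (i.castSucc.removeNth x)))

theorem lieBoundaryFormula_eq (k : ℕ) (x : Fin (k + 2) → 𝔤) :
    lieBoundaryFormula 𝔤 k x = (-(1 / 2 : ℝ)) • AlternatingMap.alternatizeUncurryFin
      (AlternatingMap.alternatizeUncurryFinLM ∘ₗ bracketWedge 𝔤 k) x := by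
  rw [AlternatingMap.alternatizeUncurryFin_alternatizeUncurryFinLM_comp_apply, Finset.smul_sum]
  refine Finset.sum_congr rfl fun i _ ↦ ?_
  rw [Finset.smul_sum]
  refine Finset.sum_congr rfl fun j _ ↦ ?_
  have h (a b : 𝔤) (z : Fin k → 𝔤) : bracketWedge 𝔤 k a b z =
      exteriorPower.ιMulti ℝ (k + 1) (Matrix.vecCons ⁅a, b⁆ z) := rfl
  have h' (a b : 𝔤) (z : Fin k → 𝔤) : bracketWedge 𝔤 k b a z = - bracketWedge 𝔤 k a b z := by
    change (exteriorPower.ιMulti ℝ (k + 1) (M := 𝔤)).curryLeft ⁅b, a⁆ z =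
      -(exteriorPower.ιMulti ℝ (k + 1) (M := 𝔤)).curryLeft ⁅a, b⁆ z
    rw [← lie_skew, map_neg, AlternatingMap.neg_apply]
  rw [h' (x i.castSucc) (x j.succ), h]
  generalize exteriorPower.ιMulti ℝ (k + 1) (M := 𝔤) _ = q
  rw [← Int.cast_smul_eq_zsmul ℝ]
  push_cast
  rw [Fin.val_castSucc, Fin.val_succ, ← add_assoc, pow_succ]
  module

/-- The alternating map `(x_0, …, x_{k+1}) ↦ ∂(x_0 ∧ ⋯ ∧ x_{k+1})`. -/
def lieBoundaryAlt (k : ℕ) : 𝔤 [⋀^Fin (k + 2)]→ₗ[ℝ] ⋀[ℝ]^(k + 1) 𝔤 where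
  toFun := lieBoundaryFormula 𝔤 k
  map_update_add' u i a b := by
    simp only [lieBoundaryFormula_eq, AlternatingMap.map_update_add, smul_add]
  map_update_smul' u i c a := by
    simp only [lieBoundaryFormula_eq, AlternatingMap.map_update_smul, smul_comm c]
  map_eq_zero_of_eq' u i j h hij := by
    rw [lieBoundaryFormula_eq, AlternatingMap.map_eq_zero_of_eq _ _ h hij, smul_zero]

/-- The Lie algebra homology differential `∂_{k+1} : Λ^{k+1} 𝔤 → Λ^k 𝔤`. For `k = 0` the defining
sum is empty. -/
def lieBoundary : (k : ℕ) → ⋀[ℝ]^(k + 1) 𝔤 →ₗ[ℝ] ⋀[ℝ]^k 𝔤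
  | 0 => 0
  | k + 1 => exteriorPower.alternatingMapLinearEquiv (lieBoundaryAlt 𝔤 k)

/-- The boundaries `B_k(𝔤) = im ∂_{k+1} ⊆ Λ^k 𝔤`. -/
def boundaries (k : ℕ) : Submodule ℝ (⋀[ℝ]^k 𝔤) := LinearMap.range (lieBoundary 𝔤 k)

end Homology

section Forms

variable (E : Type*) [NormedAddCommGroup E] [NormedSpace ℝ E]
  (M : Type*) [TopologicalSpace M] [ChartedSpace E M]

/-- Pointwise differential `k`-forms (no regularity) on a manifold `M` modelled on `E`. -/
abbrev DiffForm (k : ℕ) : Type _ :=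
  (x : M) → TangentSpace 𝓘(ℝ, E) x [⋀^Fin k]→L[ℝ] ℝ

/-- The space `𝔛(M)` of smooth vector fields. -/
abbrev VectorField [IsManifold 𝓘(ℝ, E) ∞ M] : Type _ :=
  Cₛ^∞⟮𝓘(ℝ, E); E, (TangentSpace 𝓘(ℝ, E) : M → Type _)⟯

variable {E M}

/-- The expression of a form in the chart at `x₀`: its pullback by the inverse of the chart. -/
def DiffForm.inChart {k : ℕ} (η : DiffForm E M k) (x₀ : M) (y : E) : E [⋀^Fin k]→L[ℝ] ℝ :=
  ContinuousAlternatingMap.compContinuousLinearMap (M := E) (M' := E)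
    (η ((extChartAt 𝓘(ℝ, E) x₀).symm y))
    (mfderiv 𝓘(ℝ, E) 𝓘(ℝ, E) (extChartAt 𝓘(ℝ, E) x₀).symm y)

variable (E M) in
/-- The space `Ω^k(M)` of smooth `k`-forms: the forms whose expression in every chart is smooth. -/
def smoothForms (k : ℕ) : Submodule ℝ (DiffForm E M k) where
  carrier := {η | ∀ x₀ : M, ContDiffOn ℝ ∞ (η.inChart x₀) (extChartAt 𝓘(ℝ, E) x₀).target}
  zero_mem' := fun _ ↦ contDiffOn_const (c := (0 : E [⋀^Fin k]→L[ℝ] ℝ))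
  add_mem' := fun h₁ h₂ x₀ ↦ (h₁ x₀).add (h₂ x₀)
  smul_mem' := fun c _ h x₀ ↦ (h x₀).const_smul c

/-- The exterior derivative, computed at each point `x` in the chart at `x`. -/
def extD {k : ℕ} (η : DiffForm E M k) : DiffForm E M (k + 1) := fun x ↦
  ContinuousAlternatingMap.compContinuousLinearMap (M := E) (M' := E)
    (extDeriv (η.inChart x) (extChartAt 𝓘(ℝ, E) x x))
    (mfderiv 𝓘(ℝ, E) 𝓘(ℝ, E) (extChartAt 𝓘(ℝ, E) x) x)

def IsClosedForm {k : ℕ} (η : DiffForm E M k) : Prop := extD η = 0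

/-- Exactness; as there are no nonzero forms of degree `-1`, the only exact function is `0`. -/
def IsExactForm : {k : ℕ} → DiffForm E M k → Prop
  | 0, α => α = 0
  | k + 1, α => ∃ β ∈ smoothForms E M k, α = extD β

/-- Regard a `k`-form as an `l`-form when `k = l`. -/
def DiffForm.cast {k l : ℕ} (h : k = l) (η : DiffForm E M k) : DiffForm E M l := h ▸ η

variable [IsManifold 𝓘(ℝ, E) ∞ M]

/-- The interior product `ι_v η = η(v, ⋯)`. -/
def interiorProd {k : ℕ} (v : VectorField E M) (η : DiffForm E M (k + 1)) : DiffForm E M k :=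
  fun x ↦ ContinuousAlternatingMap.curryLeft (E := E) (η x) (v x)

/-- The Lie derivative `L_v = d ι_v + ι_v d`, where `ι_v` vanishes on functions. -/
def lieDerivative (v : VectorField E M) : {k : ℕ} → DiffForm E M k → DiffForm E M k
  | 0, α => interiorProd v (extD α)
  | _ + 1, α => extD (interiorProd v α) + interiorProd v (extD α)

/-- `α` is globally conserved by `v` if `L_v α` is exact. -/
def IsGloballyConserved {k : ℕ} (v : VectorField E M) (α : DiffForm E M k) : Prop :=
  IsExactForm (lieDerivative v α)

/-- `v` is a Hamiltonian vector field of the `(n-1)`-form `α` with respect to the `(n+1)`-form `η`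
(with `n = m + 1`): `dα = - ι_v η`. -/
def IsHamiltonianVectorField {m : ℕ} (η : DiffForm E M (m + 2)) (α : DiffForm E M m)
    (v : VectorField E M) : Prop :=
  extD α = - interiorProd v η

/-- `α` is a Hamiltonian `(n-1)`-form with respect to the `(n+1)`-form `η` (with `n = m + 1`). -/
def IsHamiltonianForm {m : ℕ} (η : DiffForm E M (m + 2)) (α : DiffForm E M m) : Prop :=
  α ∈ smoothForms E M m ∧ ∃ v : VectorField E M, IsHamiltonianVectorField η α v

end Forms

section Actions

variable (E : Type*) [NormedAddCommGroup E] [NormedSpace ℝ E]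
  (M : Type*) [TopologicalSpace M] [ChartedSpace E M] [IsManifold 𝓘(ℝ, E) ∞ M]
  (𝔤 : Type*) [LieRing 𝔤] [LieAlgebra ℝ 𝔤]

/-- An infinitesimal right action of `𝔤` on `M`: a Lie algebra homomorphism `𝔤 → 𝔛(M)`. -/
structure InfinitesimalAction where
  field : 𝔤 →ₗ[ℝ] VectorField E M
  field_lie : ∀ (x y : 𝔤) (q : M),
    field ⁅x, y⁆ q = _root_.VectorField.mlieBracket 𝓘(ℝ, E) (field x) (field y) q

variable {E M 𝔤}

namespace InfinitesimalAction

variable (v : InfinitesimalAction E M 𝔤)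

/-- The action preserves `η`: `L_{v_x} η = 0` for all `x`. -/
def IsMultisymplectic {k : ℕ} (η : DiffForm E M k) : Prop :=
  ∀ x : 𝔤, lieDerivative (v.field x) η = 0

/-- The action is locally `H`-preserving: `L_{v_x} H` is closed for all `x`. -/
def LocallyPreserves {k : ℕ} (H : DiffForm E M k) : Prop :=
  ∀ x : 𝔤, IsClosedForm (lieDerivative (v.field x) H)

/-- The linear map `𝔤 → T_q M`, `x ↦ v_x(q)`. -/
def fieldAt (q : M) : 𝔤 →ₗ[ℝ] E where
  toFun x := v.field x q
  map_add' x y := by rw [map_add]; rfl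
  map_smul' c x := by rw [map_smul]; rfl

/-- The contraction `ι(v_p) η`, where `v_p = v_{x_1} ∧ ⋯ ∧ v_{x_k}` for `p = x_1 ∧ ⋯ ∧ x_k`,
extended linearly to all `p ∈ Λ^k 𝔤`. -/
def contraction {k l : ℕ} (p : ⋀[ℝ]^k 𝔤) (η : DiffForm E M (l + k)) : DiffForm E M l := fun q ↦
  contract (V := E) (η q) (exteriorPower.map k (v.fieldAt q) p)

end InfinitesimalAction

/-- The sign `ς(k) = -(-1)^{k(k+1)/2}`. -/
def sgn (k : ℕ) : ℝ := -(-1) ^ (k * (k + 1) / 2)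

/-- An `L_∞`-morphism from `𝔤` to the Lie `n`-algebra of observables of the pre-`n`-plectic
manifold `(M, η)` covering the action `v`, where `n = m + 1`. The component `f_i : Λ^i 𝔤 → Ω^j(M)`,
`j = n - i`, is `component i j _`, and `f_0 = 0`. The defining equation
`-f_{k-1}(∂p) = d f_k(p) + ς(k) ι(v_p) η` is `main` for `k = i + 1 ≤ n`,
and `main_top` for `k = n + 1`, where the term with `f_{n+1} = 0` is absent. -/
structure LInftyMorphism {m : ℕ} (η : DiffForm E M (m + 2)) (v : InfinitesimalAction E M 𝔤) where
  component : (i j : ℕ) → i + j = m + 1 → (⋀[ℝ]^i 𝔤 →ₗ[ℝ] smoothForms E M j)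
  component_zero : ∀ (j : ℕ) (h : 0 + j = m + 1), component 0 j h = 0
  isHamiltonian : ∀ p : ⋀[ℝ]^1 𝔤,
    IsHamiltonianForm η (component 1 m (Nat.add_comm 1 m) p : DiffForm E M m)
  main : ∀ (i j : ℕ) (h : (i + 1) + j = m + 1) (p : ⋀[ℝ]^(i + 1) 𝔤),
    -(component i (j + 1) (by omega) (lieBoundary 𝔤 i p) : DiffForm E M (j + 1)) =
      extD (component (i + 1) j h p : DiffForm E M j) +
        sgn (i + 1) • v.contraction p (η.cast (show m + 2 = (j + 1) + (i + 1) by omega))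
  main_top : ∀ p : ⋀[ℝ]^(m + 2) 𝔤,
    -(component (m + 1) 0 rfl (lieBoundary 𝔤 (m + 1) p) : DiffForm E M 0) =
      sgn (m + 2) • v.contraction p (η.cast (show m + 2 = 0 + (m + 2) by omega))

/-- A (homotopy) co-momentum map for the action `v`: an `L_∞`-morphism such that
`d(f_1(x)) = -ι_{v_x} η` for all `x ∈ 𝔤`. -/
structure CoMomentumMap {m : ℕ} (η : DiffForm E M (m + 2)) (v : InfinitesimalAction E M 𝔤)
    extends LInftyMorphism η v where
  moment : ∀ x : 𝔤, IsHamiltonianVectorField η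
    (component 1 m (Nat.add_comm 1 m) (exteriorPower.ιMulti ℝ 1 ![x]) : DiffForm E M m)
    (v.field x)

end Actions

end Multisymplectic

end

/-! Write p = ∂q. Applying d to the moment equation in degree k+1 kills d f_{k+1}(q) and leaves d
f_k(∂q) = -ς(k+1) d ι(v_q)ω. For any closed invariant form θ one has the transgression formula d
ι(v_q)θ = (-1)^{k+1} ι(v_{∂q})θ (`extD_contraction`), so d f_k(p) is a sign times ι(v_p)ω.
Contracting with v_H and moving v_H past the v_x replaces ω by dH, up to sign, because ι_{v_H}ω =
-dH.

Since the action is locally H-preserving, dH is itself closed and invariant, so the same formula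
applies to it, read backwards: ι(v_{∂q})dH = ± d ι(v_q)dH. Hence ι_{v_H} d f_k(p) is exact, and
L_{v_H} f_k(p) = d ι_{v_H} f_k(p) + ι_{v_H} d f_k(p) is exact. For k = n the form ι(v_p)dH is a
function and must vanish; this is `contraction_lieBoundary_eq_zero`.

The transgression formula is proved by induction on the number of factors from three ingredients:
Cartan's formula, the recursion ∂(x∧z) = -x∧∂z - ad_x z (`map_lieBoundary_vecCons`), and L_v ι_w =
ι_w L_v + ι_{[v,w]} (`lieDerivative_interiorProd`). The last is checked in charts, through the
classical coordinate expression of the Lie derivative. -/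

noncomputable section

namespace Multisymplectic

/-! ### Lie derivatives of forms on a normed space. -/

section VectorSpace

variable {E : Type*} [NormedAddCommGroup E] [NormedSpace ℝ E] {k : ℕ}

variable (E k) in
/-- Currying in the first variable as a continuous linear map. -/
def curryLeftCLM : (E [⋀^Fin (k + 1)]→L[ℝ] ℝ) →L[ℝ] (E →L[ℝ] E [⋀^Fin k]→L[ℝ] ℝ) :=
  ContinuousAlternatingMap.curryLeftLI.toContinuousLinearMap

theorem contDiffOn_curryLeft {A : E → E [⋀^Fin (k + 1)]→L[ℝ] ℝ} {V : E → E} {s : Set E}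
    (hA : ContDiffOn ℝ ∞ A s) (hV : ContDiffOn ℝ ∞ V s) :
    ContDiffOn ℝ ∞ (fun z ↦ (A z).curryLeft (V z)) s :=
  have hc : ContDiff ℝ ∞ (curryLeftCLM E k) :=
    ContinuousLinearMap.contDiff (F := E →L[ℝ] E [⋀^Fin k]→L[ℝ] ℝ) _
  have h : ContDiffOn ℝ ∞ (fun z ↦ (A z).curryLeft) s := hc.comp_contDiffOn hA
  h.clm_apply hV

theorem differentiableAt_curryLeft {A : E → E [⋀^Fin (k + 1)]→L[ℝ] ℝ} {V : E → E} {y : E}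
    (hA : DifferentiableAt ℝ A y) (hV : DifferentiableAt ℝ V y) :
    DifferentiableAt ℝ (fun z ↦ (A z).curryLeft (V z)) y :=
  have hc : DifferentiableAt ℝ (curryLeftCLM E k) (A y) :=
    ContinuousLinearMap.differentiableAt (F := E →L[ℝ] E [⋀^Fin k]→L[ℝ] ℝ) _
  have h : DifferentiableAt ℝ (fun z ↦ (A z).curryLeft) y :=
    DifferentiableAt.comp (G := E →L[ℝ] E [⋀^Fin k]→L[ℝ] ℝ) (g := curryLeftCLM E k) y hc hA
  h.clm_apply hV

/-- Product rule for a form with a varying vector in its first slot and constant vectors in the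
others. -/
theorem fderiv_curryLeft_apply {A : E → E [⋀^Fin (k + 1)]→L[ℝ] ℝ} {V : E → E} {y : E}
    (hA : DifferentiableAt ℝ A y) (hV : DifferentiableAt ℝ V y) (h : E) (u : Fin k → E) :
    fderiv ℝ (fun z ↦ (A z).curryLeft (V z)) y h u =
      A y (Matrix.vecCons (fderiv ℝ V y h) u) + fderiv ℝ A y h (Matrix.vecCons (V y) u) := by
  rw [← fderiv_continuousAlternatingMap_apply_const_apply (differentiableAt_curryLeft hA hV)]
  have hg (i : Fin (k + 1)) : DifferentiableAt ℝ (fun z ↦ Matrix.vecCons (V z) u i) y := by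
    refine Fin.cases ?_ (fun i ↦ ?_) i
    · simpa using hV
    · simp
  have := fderiv_continuousAlternatingMap_apply_apply hA hg h
  simp only [ContinuousAlternatingMap.curryLeft_apply_apply]
  rw [this, Fin.sum_univ_succ, Finset.sum_eq_zero, add_zero, add_comm]
  · congr 2
    exact Fin.update_cons_zero (α := fun _ ↦ E) (V y) u _
  · intro i _
    refine (A y).map_coord_zero i.succ ?_
    simp

/-- The coordinate expression of the Lie derivative `L_V A` at `y`, evaluated at vectors `u i`. -/
def lieEval (V : E → E) (A : E → E [⋀^Fin k]→L[ℝ] ℝ) (y : E) (u : Fin k → E) : ℝ :=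
  fderiv ℝ A y (V y) u + ∑ i, A y (Function.update u i (fderiv ℝ V y (u i)))

theorem curryLeft_extDeriv_eq_lieEval (A : E → E [⋀^Fin 0]→L[ℝ] ℝ) (V : E → E) (y : E)
    (u : Fin 0 → E) : (extDeriv A y).curryLeft (V y) u = lieEval V A y u := by
  rw [ContinuousAlternatingMap.curryLeft_apply_apply, extDeriv,
    ContinuousAlternatingMap.alternatizeUncurryFin_apply]
  simp [lieEval]

/-- Cartan's formula in coordinates. -/
theorem cartan_eq_lieEval {A : E → E [⋀^Fin (k + 1)]→L[ℝ] ℝ} {V : E → E} {y : E}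
    (hA : DifferentiableAt ℝ A y) (hV : DifferentiableAt ℝ V y) (u : Fin (k + 1) → E) :
    extDeriv (fun z ↦ (A z).curryLeft (V z)) y u + (extDeriv A y).curryLeft (V y) u =
      lieEval V A y u := by
  rw [ContinuousAlternatingMap.curryLeft_apply_apply, extDeriv, extDeriv,
    ContinuousAlternatingMap.alternatizeUncurryFin_apply,
    ContinuousAlternatingMap.alternatizeUncurryFin_apply, Fin.sum_univ_succ (n := k + 1), lieEval]
  -- The terms of d ι_V A that differentiate `A` along `u i` cancel the tail of ι_V dA; what
  -- survives is the derivative of `A` along `V` and the terms containing the derivative of `V`.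
  simp only [fderiv_curryLeft_apply hA hV, smul_add, Finset.sum_add_distrib]
  have h0 : Fin.removeNth 0 (Matrix.vecCons (V y) u) = u := by
    ext i; simp [Fin.removeNth]
  have h1 (i : Fin (k + 1)) : Fin.removeNth i.succ (Matrix.vecCons (V y) u) =
      Matrix.vecCons (V y) (Fin.removeNth i u) := by
    ext j
    refine Fin.cases ?_ (fun j ↦ ?_) j <;> simp [Fin.removeNth]
  have h2 (i : Fin (k + 1)) : A y (Function.update u i (fderiv ℝ V y (u i))) =
      (-1) ^ (i : ℕ) • A y (Matrix.vecCons (fderiv ℝ V y (u i)) (Fin.removeNth i u)) := by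
    rw [← ContinuousAlternatingMap.map_insertNth, Fin.insertNth_removeNth]
  simp only [h0, h1, h2, Matrix.cons_val_succ, Matrix.cons_val_zero, Fin.val_succ, pow_succ]
  simp only [Fin.val_zero, pow_zero, one_smul, mul_neg, mul_one, neg_smul, Finset.sum_neg_distrib]
  ring

/-- Only first derivatives occur: the product rule contributes DW(V) in the first slot, while
inserting `W y` as an argument contributes DV(W) there. Their difference is the bracket. -/
theorem lieEval_curryLeft {A : E → E [⋀^Fin (k + 1)]→L[ℝ] ℝ} {V W : E → E} {y : E}
    (hA : DifferentiableAt ℝ A y) (hW : DifferentiableAt ℝ W y) (u : Fin k → E) :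
    lieEval V (fun z ↦ (A z).curryLeft (W z)) y u =
      lieEval V A y (Matrix.vecCons (W y) u) +
        A y (Matrix.vecCons (VectorField.lieBracket ℝ V W y) u) := by
  have h1 (i : Fin k) (a : E) : Function.update (Matrix.vecCons (W y) u) i.succ a =
      Matrix.vecCons (W y) (Function.update u i a) :=
    (Fin.cons_update (α := fun _ ↦ E) (W y) u i a).symm
  have h0 (a : E) : Function.update (Matrix.vecCons (W y) u) 0 a = Matrix.vecCons a u :=
    Fin.update_cons_zero (α := fun _ ↦ E) (W y) u a
  have h2 : A y (Matrix.vecCons (VectorField.lieBracket ℝ V W y) u) =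
      A y (Matrix.vecCons (fderiv ℝ W y (V y)) u) -
        A y (Matrix.vecCons (fderiv ℝ V y (W y)) u) := by
    rw [VectorField.lieBracket_eq]
    simp only [← ContinuousAlternatingMap.curryLeft_apply_apply, map_sub,
      ContinuousAlternatingMap.sub_apply]
  simp only [lieEval, fderiv_curryLeft_apply hA hW, Fin.sum_univ_succ, h0, h1, h2,
    Matrix.cons_val_zero, Matrix.cons_val_succ, ContinuousAlternatingMap.curryLeft_apply_apply]
  ring

end VectorSpace

/-! ### Transfer from charts to the manifold. -/

section Charts

theorem minSmoothness_two_le : minSmoothness ℝ 2 ≤ (∞ : WithTop ℕ∞) := by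
  rw [minSmoothness_of_isRCLikeNormedField]
  exact WithTop.coe_le_coe.2 le_top

variable {E : Type*} [NormedAddCommGroup E] [NormedSpace ℝ E]
  {M : Type*} [TopologicalSpace M] [ChartedSpace E M]

/-- The derivative at `x` of the chart at `x₀`. -/
def chartDeriv (x₀ x : M) : E →L[ℝ] E := mfderiv 𝓘(ℝ, E) 𝓘(ℝ, E) (extChartAt 𝓘(ℝ, E) x₀) x

/-- The derivative at `y` of the inverse of the chart at `x₀`. -/
def chartSymmDeriv (x₀ : M) (y : E) : E →L[ℝ] E :=
  mfderiv 𝓘(ℝ, E) 𝓘(ℝ, E) (extChartAt 𝓘(ℝ, E) x₀).symm y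

/-- Forms with the tangent spaces identified with the model space. -/
def DiffForm.toModel {k : ℕ} (η : DiffForm E M k) (x : M) : E [⋀^Fin k]→L[ℝ] ℝ := η x

theorem DiffForm.inChart_eq {k : ℕ} (η : DiffForm E M k) (x₀ : M) (y : E) :
    η.inChart x₀ y = (η.toModel ((extChartAt 𝓘(ℝ, E) x₀).symm y)).compContinuousLinearMap
      (chartSymmDeriv x₀ y) := rfl

theorem toModel_extD {k : ℕ} (η : DiffForm E M k) (x : M) :
    (extD η).toModel x = (extDeriv (η.inChart x) (extChartAt 𝓘(ℝ, E) x x)).compContinuousLinearMap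
      (chartDeriv x x) := rfl

theorem DiffForm.ext_toModel {k : ℕ} {η θ : DiffForm E M k}
    (h : ∀ x u, η.toModel x u = θ.toModel x u) : η = θ :=
  funext fun x ↦ ContinuousAlternatingMap.ext (h x)

theorem target_mem_nhds {x₀ : M} {y : E} (hy : y ∈ (extChartAt 𝓘(ℝ, E) x₀).target) :
    (extChartAt 𝓘(ℝ, E) x₀).target ∈ nhds y :=
  (isOpen_extChartAt_target x₀).mem_nhds hy

theorem differentiableAt_inChart {k : ℕ} {η : DiffForm E M k} (hη : η ∈ smoothForms E M k)
    {x₀ : M} {y : E} (hy : y ∈ (extChartAt 𝓘(ℝ, E) x₀).target) :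
    DifferentiableAt ℝ (η.inChart x₀) y :=
  ((hη x₀).contDiffAt (target_mem_nhds hy)).differentiableAt (by simp)

variable [IsManifold 𝓘(ℝ, E) ∞ M]

/-- Vector fields with the tangent spaces identified with the model space. -/
def toModelField (v : VectorField E M) (x : M) : E := v x

theorem toModel_interiorProd {k : ℕ} (v : VectorField E M) (η : DiffForm E M (k + 1)) (x : M) :
    (interiorProd v η).toModel x = (η.toModel x).curryLeft (toModelField v x) := rfl

theorem chartDeriv_comp_chartSymmDeriv {x₀ : M} {y : E}
    (hy : y ∈ (extChartAt 𝓘(ℝ, E) x₀).target) :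
    chartDeriv x₀ ((extChartAt 𝓘(ℝ, E) x₀).symm y) ∘L chartSymmDeriv x₀ y =
      ContinuousLinearMap.id ℝ E := by
  have := mfderiv_extChartAt_comp_mfderivWithin_extChartAt_symm (I := 𝓘(ℝ, E)) hy
  rw [ModelWithCorners.range_eq_univ, mfderivWithin_univ] at this
  exact this

theorem chartSymmDeriv_comp_chartDeriv {x₀ : M} {y : E}
    (hy : y ∈ (extChartAt 𝓘(ℝ, E) x₀).target) :
    chartSymmDeriv x₀ y ∘L chartDeriv x₀ ((extChartAt 𝓘(ℝ, E) x₀).symm y) =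
      ContinuousLinearMap.id ℝ E := by
  have := mfderivWithin_extChartAt_symm_comp_mfderiv_extChartAt (I := 𝓘(ℝ, E)) hy
  rw [ModelWithCorners.range_eq_univ, mfderivWithin_univ] at this
  exact this

/-- The tangent space at `x` is modelled on `E` through the preferred chart at `x`. Hence at the
base point of its own chart an object and its chart expression coincide, which lets pointwise
identities be checked there. -/
theorem chartDeriv_self (x : M) : chartDeriv (E := E) x x = ContinuousLinearMap.id ℝ E :=
  mfderiv_extChartAt_self

theorem chartSymmDeriv_self (x : M) :
    chartSymmDeriv x (extChartAt 𝓘(ℝ, E) x x) = ContinuousLinearMap.id ℝ E := by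
  have := mfderivWithin_range_extChartAt_symm (I := 𝓘(ℝ, E)) (x := x)
  rw [ModelWithCorners.range_eq_univ, mfderivWithin_univ] at this
  exact this

/-- The expression of a vector field in the chart at `x₀`. -/
def fieldInChart (v : VectorField E M) (x₀ : M) (y : E) : E :=
  chartDeriv x₀ ((extChartAt 𝓘(ℝ, E) x₀).symm y) (toModelField v ((extChartAt 𝓘(ℝ, E) x₀).symm y))

theorem inChart_interiorProd {k : ℕ} (v : VectorField E M) (η : DiffForm E M (k + 1)) {x₀ : M}
    {y : E} (hy : y ∈ (extChartAt 𝓘(ℝ, E) x₀).target) :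
    (interiorProd v η).inChart x₀ y = (η.inChart x₀ y).curryLeft (fieldInChart v x₀ y) := by
  rw [DiffForm.inChart_eq, DiffForm.inChart_eq, toModel_interiorProd,
    ContinuousAlternatingMap.curryLeft_compContinuousLinearMap, fieldInChart,
    ← ContinuousLinearMap.comp_apply (chartSymmDeriv x₀ y), chartSymmDeriv_comp_chartDeriv hy]
  rfl

theorem fieldInChart_self (v : VectorField E M) (x : M) :
    fieldInChart v x (extChartAt 𝓘(ℝ, E) x x) = toModelField v x := by
  rw [fieldInChart, extChartAt_to_inv x, chartDeriv_self]
  rfl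

theorem inChart_self {k : ℕ} (η : DiffForm E M k) (x : M) :
    η.inChart x (extChartAt 𝓘(ℝ, E) x x) = η.toModel x := by
  rw [DiffForm.inChart_eq, extChartAt_to_inv x, chartSymmDeriv_self]
  rfl

theorem toModel_extD_eq {k : ℕ} (η : DiffForm E M k) (x : M) :
    (extD η).toModel x = extDeriv (η.inChart x) (extChartAt 𝓘(ℝ, E) x x) := by
  rw [toModel_extD, chartDeriv_self]
  rfl

/-- Smoothness of a section is smoothness in the tangent bundle trivialization at `x₀`, and on
fibres that trivialization is the derivative of the chart. -/
theorem contDiffOn_fieldInChart (v : VectorField E M) (x₀ : M) :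
    ContDiffOn ℝ ∞ (fieldInChart v x₀) (extChartAt 𝓘(ℝ, E) x₀).target := by
  have h := ((trivializationAt E (TangentSpace 𝓘(ℝ, E) : M → Type _)
    x₀).contMDiffOn_section_baseSet_iff (IB := 𝓘(ℝ, E)) (n := ∞) (s := v)).1
    v.contMDiff.contMDiffOn
  have hs := contMDiffOn_extChartAt_symm (I := 𝓘(ℝ, E)) (n := ∞) x₀
  have hm : Set.MapsTo (extChartAt 𝓘(ℝ, E) x₀).symm (extChartAt 𝓘(ℝ, E) x₀).target
      (trivializationAt E (TangentSpace 𝓘(ℝ, E) : M → Type _) x₀).baseSet := fun y hy ↦ by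
    have := (extChartAt 𝓘(ℝ, E) x₀).map_target hy
    rwa [extChartAt_source] at this
  refine (contMDiffOn_iff_contDiffOn.1 (h.comp hs hm)).congr fun y hy ↦ ?_
  have hb := hm hy
  have hx : (extChartAt 𝓘(ℝ, E) x₀).symm y ∈ (chartAt E x₀).source := hb
  have h1 := TangentBundle.continuousLinearMapAt_trivializationAt (I := 𝓘(ℝ, E)) hx
  have h2 := (trivializationAt E (TangentSpace 𝓘(ℝ, E) : M → Type _)
    x₀).continuousLinearMapAt_apply_of_mem (R := ℝ) hb (v ((extChartAt 𝓘(ℝ, E) x₀).symm y))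
  rw [h1] at h2
  exact h2

theorem interiorProd_mem_smoothForms {k : ℕ} (v : VectorField E M) {η : DiffForm E M (k + 1)}
    (hη : η ∈ smoothForms E M (k + 1)) : interiorProd v η ∈ smoothForms E M k := fun x₀ ↦
  (contDiffOn_curryLeft (hη x₀) (contDiffOn_fieldInChart v x₀)).congr
    fun _ hy ↦ inChart_interiorProd v η hy

theorem differentiableAt_fieldInChart (v : VectorField E M)
    {x₀ : M} {y : E} (hy : y ∈ (extChartAt 𝓘(ℝ, E) x₀).target) :
    DifferentiableAt ℝ (fieldInChart v x₀) y :=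
  ((contDiffOn_fieldInChart v x₀).contDiffAt (target_mem_nhds hy)).differentiableAt (by simp)

/-- The transition map from the chart at `x₀` to the chart at `x₁`. -/
def transition (x₀ x₁ : M) (y : E) : E :=
  extChartAt 𝓘(ℝ, E) x₁ ((extChartAt 𝓘(ℝ, E) x₀).symm y)

theorem contMDiffAt_chart_symm {x₀ : M} {y : E} (hy : y ∈ (extChartAt 𝓘(ℝ, E) x₀).target) :
    ContMDiffAt 𝓘(ℝ, E) 𝓘(ℝ, E) ∞ (extChartAt 𝓘(ℝ, E) x₀).symm y :=
  (contMDiffOn_extChartAt_symm x₀).contMDiffAt (target_mem_nhds hy)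

theorem contDiffAt_transition {x₀ x₁ : M} {y : E} (hy : y ∈ (extChartAt 𝓘(ℝ, E) x₀).target)
    (hx : (extChartAt 𝓘(ℝ, E) x₀).symm y ∈ (chartAt E x₁).source) :
    ContDiffAt ℝ ∞ (transition (E := E) x₀ x₁) y :=
  contMDiffAt_iff_contDiffAt.1 <|
    ContMDiffAt.comp (I' := 𝓘(ℝ, E)) y (contMDiffAt_extChartAt' hx) (contMDiffAt_chart_symm hy)

theorem fderiv_transition {x₀ x₁ : M} {y : E} (hy : y ∈ (extChartAt 𝓘(ℝ, E) x₀).target)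
    (hx : (extChartAt 𝓘(ℝ, E) x₀).symm y ∈ (chartAt E x₁).source) :
    fderiv ℝ (transition (E := E) x₀ x₁) y =
      chartDeriv x₁ ((extChartAt 𝓘(ℝ, E) x₀).symm y) ∘L chartSymmDeriv x₀ y := by
  rw [← mfderiv_eq_fderiv]
  exact mfderiv_comp (I' := 𝓘(ℝ, E)) y (mdifferentiableAt_extChartAt hx)
    ((contMDiffAt_chart_symm hy).mdifferentiableAt (by simp))

theorem inChart_eq_pullback_transition {k : ℕ} (η : DiffForm E M k) {x₀ x₁ : M} {y : E}
    (hy : y ∈ (extChartAt 𝓘(ℝ, E) x₀).target)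
    (hx : (extChartAt 𝓘(ℝ, E) x₀).symm y ∈ (chartAt E x₁).source) :
    η.inChart x₀ y = (η.inChart x₁ (transition x₀ x₁ y)).compContinuousLinearMap
      (fderiv ℝ (transition (E := E) x₀ x₁) y) := by
  have hx' : (extChartAt 𝓘(ℝ, E) x₀).symm y ∈ (extChartAt 𝓘(ℝ, E) x₁).source := by
    rwa [extChartAt_source]
  have ht : transition x₀ x₁ y ∈ (extChartAt 𝓘(ℝ, E) x₁).target :=
    (extChartAt 𝓘(ℝ, E) x₁).map_source hx'
  have hi : (extChartAt 𝓘(ℝ, E) x₁).symm (transition x₀ x₁ y) =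
      (extChartAt 𝓘(ℝ, E) x₀).symm y := (extChartAt 𝓘(ℝ, E) x₁).left_inv hx'
  have hc := chartSymmDeriv_comp_chartDeriv ht
  rw [hi] at hc
  rw [fderiv_transition hy hx, DiffForm.inChart_eq, DiffForm.inChart_eq, hi]
  ext u
  simp only [ContinuousAlternatingMap.compContinuousLinearMap_apply]
  congr 1
  ext i
  have := DFunLike.congr_fun hc (chartSymmDeriv x₀ y (u i))
  exact this.symm

/-- `extD` uses a different chart at each point. Independence of the chart follows because the two
chart expressions differ near `y` by pullback along the transition map, and the exterior derivative
commutes with pullback. This is what gives smoothness of dη and d² = 0. -/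
theorem inChart_extD {k : ℕ} {η : DiffForm E M k} (hη : η ∈ smoothForms E M k) {x₀ : M} {y : E}
    (hy : y ∈ (extChartAt 𝓘(ℝ, E) x₀).target) :
    (extD η).inChart x₀ y = extDeriv (η.inChart x₀) y := by
  set x := (extChartAt 𝓘(ℝ, E) x₀).symm y with hxdef
  have hx : (extChartAt 𝓘(ℝ, E) x₀).symm y ∈ (chartAt E x).source := mem_chart_source E x
  have hev : η.inChart x₀ =ᶠ[nhds y] fun z ↦
      (η.inChart x (transition x₀ x z)).compContinuousLinearMap
        (fderiv ℝ (transition (E := E) x₀ x) z) := by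
    have hc : ContinuousAt (extChartAt 𝓘(ℝ, E) x₀).symm y := (contMDiffAt_chart_symm hy).continuousAt
    filter_upwards [target_mem_nhds hy,
      hc.preimage_mem_nhds ((chartAt E x).open_source.mem_nhds hx)] with z hz hz'
    exact inChart_eq_pullback_transition η hz hz'
  have ht : transition x₀ x y = extChartAt 𝓘(ℝ, E) x x := rfl
  rw [hev.extDeriv_eq, extDeriv_pullback (r := ∞) _ (contDiffAt_transition hy hx) minSmoothness_two_le,
    fderiv_transition hy hx, ht, DiffForm.inChart_eq, ← hxdef, toModel_extD]
  · rfl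
  · rw [ht]
    exact differentiableAt_inChart hη (mem_extChartAt_target x)

theorem extD_mem_smoothForms {k : ℕ} {η : DiffForm E M k} (hη : η ∈ smoothForms E M k) :
    extD η ∈ smoothForms E M (k + 1) := fun x₀ ↦ by
  have h1 : ContDiffOn ℝ ∞ (fderiv ℝ (η.inChart x₀)) (extChartAt 𝓘(ℝ, E) x₀).target :=
    (hη x₀).fderiv_of_isOpen (isOpen_extChartAt_target x₀) (by simp)
  have h2 : ContDiff ℝ ∞ (ContinuousAlternatingMap.alternatizeUncurryFinCLM (n := k) ℝ E ℝ) :=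
    ContinuousLinearMap.contDiff (E := E →L[ℝ] E [⋀^Fin k]→L[ℝ] ℝ) _
  exact (h2.comp_contDiffOn h1).congr fun y hy ↦ inChart_extD hη hy

theorem extD_extD {k : ℕ} {η : DiffForm E M k} (hη : η ∈ smoothForms E M k) :
    extD (extD η) = 0 := DiffForm.ext_toModel fun x u ↦ by
  have hx := mem_extChartAt_target (I := 𝓘(ℝ, E)) x
  have hev : (extD η).inChart x =ᶠ[nhds (extChartAt 𝓘(ℝ, E) x x)] extDeriv (η.inChart x) := by
    filter_upwards [target_mem_nhds hx] with y hy using inChart_extD hη hy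
  rw [toModel_extD_eq, hev.extDeriv_eq,
    extDeriv_extDeriv_apply ((hη x).contDiffAt (target_mem_nhds hx)) minSmoothness_two_le]
  rfl

theorem extD_add {k : ℕ} {η θ : DiffForm E M k} (hη : η ∈ smoothForms E M k)
    (hθ : θ ∈ smoothForms E M k) : extD (η + θ) = extD η + extD θ :=
  DiffForm.ext_toModel fun x u ↦ by
    have hx := mem_extChartAt_target (I := 𝓘(ℝ, E)) x
    have := extDeriv_add (differentiableAt_inChart hη hx) (differentiableAt_inChart hθ hx)
    rw [toModel_extD_eq]
    refine (DFunLike.congr_fun this u).trans ?_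
    rw [← toModel_extD_eq, ← toModel_extD_eq]
    rfl

theorem extD_smul {k : ℕ} (c : ℝ) (η : DiffForm E M k) : extD (c • η) = c • extD η :=
  DiffForm.ext_toModel fun x u ↦ by
    have := extDeriv_smul (x := extChartAt 𝓘(ℝ, E) x x) c (η.inChart x)
    rw [toModel_extD_eq]
    refine (DFunLike.congr_fun this u).trans ?_
    rw [← toModel_extD_eq]
    rfl

/-- Puts functions and forms of positive degree, for which `lieDerivative` is defined by separate
clauses, on the same footing. -/
theorem toModel_lieDerivative {k : ℕ} (v : VectorField E M) {η : DiffForm E M k}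
    (hη : η ∈ smoothForms E M k) (x : M) (u : Fin k → E) :
    (lieDerivative v η).toModel x u =
      lieEval (fieldInChart v x) (η.inChart x) (extChartAt 𝓘(ℝ, E) x x) u := by
  have hx := mem_extChartAt_target (I := 𝓘(ℝ, E)) x
  cases k with
  | zero =>
    rw [← curryLeft_extDeriv_eq_lieEval, ← toModel_extD_eq, fieldInChart_self]
    rfl
  | succ k =>
    have hev : (interiorProd v η).inChart x =ᶠ[nhds (extChartAt 𝓘(ℝ, E) x x)]
        fun z ↦ (η.inChart x z).curryLeft (fieldInChart v x z) := by
      filter_upwards [target_mem_nhds hx] with y hy using inChart_interiorProd v η hy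
    rw [← cartan_eq_lieEval (differentiableAt_inChart hη hx) (differentiableAt_fieldInChart v hx),
      ← hev.extDeriv_eq, ← toModel_extD_eq, ← toModel_extD_eq, fieldInChart_self]
    rfl

theorem mpullbackWithin_eq_fieldInChart (v : VectorField E M) {x₀ : M} {y : E}
    (hy : y ∈ (extChartAt 𝓘(ℝ, E) x₀).target) :
    _root_.VectorField.mpullbackWithin 𝓘(ℝ, E) 𝓘(ℝ, E) (extChartAt 𝓘(ℝ, E) x₀).symm v
      (Set.range 𝓘(ℝ, E)) y = fieldInChart v x₀ y := by
  rw [ModelWithCorners.range_eq_univ, VectorField.mpullbackWithin_univ,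
    VectorField.mpullback_apply]
  have h : (chartSymmDeriv x₀ y).inverse = chartDeriv x₀ ((extChartAt 𝓘(ℝ, E) x₀).symm y) :=
    ContinuousLinearMap.inverse_eq (chartSymmDeriv_comp_chartDeriv hy)
      (chartDeriv_comp_chartSymmDeriv hy)
  exact DFunLike.congr_fun h (toModelField v ((extChartAt 𝓘(ℝ, E) x₀).symm y))

/-- The bracket on a manifold is defined by pulling the fields back along the inverse chart, which
near the base point gives exactly their chart expressions. -/
theorem lieBracket_fieldInChart (v w : VectorField E M) (x : M) :
    VectorField.lieBracket ℝ (fieldInChart v x) (fieldInChart w x) (extChartAt 𝓘(ℝ, E) x x) =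
      (_root_.VectorField.mlieBracket 𝓘(ℝ, E) v w x : E) := by
  let V (v : VectorField E M) : E → E :=
    _root_.VectorField.mpullbackWithin 𝓘(ℝ, E) 𝓘(ℝ, E) (extChartAt 𝓘(ℝ, E) x).symm v
      (Set.range 𝓘(ℝ, E))
  have hev (v : VectorField E M) : fieldInChart v x =ᶠ[nhds (extChartAt 𝓘(ℝ, E) x x)] V v := by
    filter_upwards [target_mem_nhds (mem_extChartAt_target (I := 𝓘(ℝ, E)) x)] with y hy
    exact (mpullbackWithin_eq_fieldInChart v hy).symm
  have h : (_root_.VectorField.mlieBracket 𝓘(ℝ, E) v w x : E) = (chartDeriv (E := E) x x).inverse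
      (VectorField.lieBracketWithin ℝ (V v) (V w)
        ((extChartAt 𝓘(ℝ, E) x).symm ⁻¹' Set.univ ∩ Set.range 𝓘(ℝ, E))
        (extChartAt 𝓘(ℝ, E) x x)) :=
    VectorField.mlieBracketWithin_apply (s := Set.univ)
  rw [(hev v).lieBracket_vectorField_eq (hev w)]
  refine Eq.trans ?_ h.symm
  rw [chartDeriv_self, ContinuousLinearMap.inverse_id, Set.preimage_univ, Set.univ_inter,
    ModelWithCorners.range_eq_univ, VectorField.lieBracketWithin_univ]
  rfl

theorem lieDerivative_interiorProd {k : ℕ} (v w b : VectorField E M)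
    (hb : ∀ x, b x = _root_.VectorField.mlieBracket 𝓘(ℝ, E) v w x)
    {η : DiffForm E M (k + 1)} (hη : η ∈ smoothForms E M (k + 1)) :
    lieDerivative v (interiorProd w η) =
      interiorProd w (lieDerivative v η) + interiorProd b η := DiffForm.ext_toModel fun x u ↦ by
  have hx := mem_extChartAt_target (I := 𝓘(ℝ, E)) x
  have hev : (interiorProd w η).inChart x =ᶠ[nhds (extChartAt 𝓘(ℝ, E) x x)]
      fun z ↦ (η.inChart x z).curryLeft (fieldInChart w x z) := by
    filter_upwards [target_mem_nhds hx] with y hy using inChart_interiorProd w η hy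
  have h1 : lieEval (fieldInChart v x) ((interiorProd w η).inChart x)
      (extChartAt 𝓘(ℝ, E) x x) u = lieEval (fieldInChart v x)
        (fun z ↦ (η.inChart x z).curryLeft (fieldInChart w x z)) (extChartAt 𝓘(ℝ, E) x x) u := by
    rw [lieEval, lieEval, hev.fderiv_eq, hev.self_of_nhds]
  rw [toModel_lieDerivative v (interiorProd_mem_smoothForms w hη), h1,
    lieEval_curryLeft (differentiableAt_inChart hη hx) (differentiableAt_fieldInChart w hx),
    ← toModel_lieDerivative v hη, lieBracket_fieldInChart, inChart_self, fieldInChart_self, ← hb]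
  rfl

end Charts

/-! ### A recursion for the Lie algebra homology differential. -/

section Homology

variable {𝔤 : Type*} [LieRing 𝔤] [LieAlgebra ℝ 𝔤]

theorem lieBoundary_ιMulti (k : ℕ) (x : Fin (k + 2) → 𝔤) :
    lieBoundary 𝔤 (k + 1) (exteriorPower.ιMulti ℝ (k + 2) x) = lieBoundaryFormula 𝔤 k x := by
  rw [lieBoundary, exteriorPower.alternatingMapLinearEquiv_apply_ιMulti]
  rfl

theorem removeNth_succ_vecCons {α : Type*} {k : ℕ} (a : α) (z : Fin (k + 1) → α)
    (i : Fin (k + 1)) :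
    i.succ.removeNth (Matrix.vecCons a z) = Matrix.vecCons a (i.removeNth z) := by
  ext j
  refine Fin.cases ?_ (fun j ↦ ?_) j <;> simp [Fin.removeNth]

theorem map_vecCons_swap {V N : Type*} [AddCommGroup V] [Module ℝ V] [AddCommGroup N] [Module ℝ N]
    {k : ℕ} (g : V [⋀^Fin (k + 2)]→ₗ[ℝ] N) (a b : V) (z : Fin k → V) :
    g (Matrix.vecCons a (Matrix.vecCons b z)) = -g (Matrix.vecCons b (Matrix.vecCons a z)) := by
  rw [← g.map_swap _ (show (0 : Fin (k + 2)) ≠ 1 by simp)]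
  congr 1
  ext i
  refine Fin.cases ?_ (fun i ↦ Fin.cases ?_ (fun i ↦ ?_) i) i
  · simp
  · simp
  · have : Equiv.swap (0 : Fin (k + 2)) 1 i.succ.succ = i.succ.succ :=
      Equiv.swap_apply_of_ne_of_ne (Fin.succ_ne_zero _) (by
        rw [← Fin.succ_zero_eq_one]
        exact (Fin.succ_injective _).ne (Fin.succ_ne_zero _))
    simp [this]

variable {N : Type*} [AddCommGroup N] [Module ℝ N]

theorem map_update_eq_vecCons_removeNth {k : ℕ} (g : 𝔤 [⋀^Fin (k + 1)]→ₗ[ℝ] N)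
    (z : Fin (k + 1) → 𝔤) (j : Fin (k + 1)) (a : 𝔤) :
    g (Function.update z j a) = (-1 : ℝ) ^ (j : ℕ) • g (Matrix.vecCons a (j.removeNth z)) := by
  rw [← Fin.insertNth_removeNth, g.map_insertNth, ← Int.cast_smul_eq_zsmul ℝ]
  simp

theorem sum_Ici_succ {N : Type*} [AddCommMonoid N] {k : ℕ} (i : Fin k) (φ : Fin (k + 1) → N) :
    ∑ j ≥ i.succ, φ j = ∑ j ≥ i, φ j.succ := by
  rw [← Fin.map_succEmb_Ici, Finset.sum_map]
  rfl

/-- `∂(x ∧ z) = -x ∧ ∂z - ad_x z`, tested against an alternating map. -/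
theorem map_lieBoundary_vecCons {k : ℕ} (g : 𝔤 [⋀^Fin (k + 1)]→ₗ[ℝ] N) (x : 𝔤)
    (z : Fin (k + 1) → 𝔤) :
    exteriorPower.alternatingMapLinearEquiv g
      (lieBoundary 𝔤 (k + 1) (exteriorPower.ιMulti ℝ (k + 2) (Matrix.vecCons x z))) =
    -exteriorPower.alternatingMapLinearEquiv (g.curryLeft x)
        (lieBoundary 𝔤 k (exteriorPower.ιMulti ℝ (k + 1) z)) -
      ∑ j, g (Function.update z j ⁅x, z j⁆) := by
  have h0 : Fin.removeNth 0 (Matrix.vecCons x z) = z := by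
    ext i; simp [Fin.removeNth]
  rw [lieBoundary_ιMulti, lieBoundaryFormula, Fin.sum_univ_succ]
  simp only [map_add, map_sum, map_smul, exteriorPower.alternatingMapLinearEquiv_apply_ιMulti]
  rw [add_comm, sub_eq_add_neg]
  congr 1
  -- Pairs that avoid `x`: moving the bracket past `x` and shifting both indices by one gives -x∧∂z.
  -- For `k = 0` there are no such pairs and ∂₁ = 0.
  · cases k with
    | zero => simp [lieBoundary]
    | succ k =>
      rw [lieBoundary_ιMulti, lieBoundaryFormula]
      simp only [map_sum, map_smul, exteriorPower.alternatingMapLinearEquiv_apply_ιMulti,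
        ← Finset.sum_neg_distrib, sum_Ici_succ]
      refine Finset.sum_congr rfl fun i _ ↦ Finset.sum_congr rfl fun j _ ↦ ?_
      rw [← Fin.succ_castSucc, removeNth_succ_vecCons, removeNth_succ_vecCons, map_vecCons_swap,
        AlternatingMap.curryLeft_apply_apply, Matrix.cons_val_succ, Matrix.cons_val_succ]
      simp only [Fin.val_succ, Fin.val_castSucc, pow_add, pow_one]
      module
  -- Pairs formed by `x` and `z j`: bringing [x, z_j] from the front to slot `j` costs (-1)^j, which
  -- gives -ad_x z.
  · rw [show (Finset.Ici (0 : Fin (k + 1))) = Finset.univ from Finset.Ici_bot,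
      ← Finset.sum_neg_distrib]
    refine Finset.sum_congr rfl fun j _ ↦ ?_
    rw [map_update_eq_vecCons_removeNth, Fin.castSucc_zero, h0, Matrix.cons_val_zero,
      Matrix.cons_val_succ]
    simp only [Fin.val_succ, Fin.val_zero, zero_add, pow_succ]
    module

/-- `∂(x ∧ z) = -x ∧ ∂z - ad_x z`, tested against a linear map. -/
theorem linearMap_lieBoundary_vecCons {k : ℕ} (G : ⋀[ℝ]^(k + 1) 𝔤 →ₗ[ℝ] N)
    (G' : ⋀[ℝ]^k 𝔤 →ₗ[ℝ] N) (x : 𝔤)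
    (hG : ∀ y : Fin k → 𝔤, G' (exteriorPower.ιMulti ℝ k y) =
      G (exteriorPower.ιMulti ℝ (k + 1) (Matrix.vecCons x y))) (z : Fin (k + 1) → 𝔤) :
    G (lieBoundary 𝔤 (k + 1) (exteriorPower.ιMulti ℝ (k + 2) (Matrix.vecCons x z))) =
      -G' (lieBoundary 𝔤 k (exteriorPower.ιMulti ℝ (k + 1) z)) -
        ∑ j, G (exteriorPower.ιMulti ℝ (k + 1) (Function.update z j ⁅x, z j⁆)) := by
  have h1 : G = exteriorPower.alternatingMapLinearEquiv
      (G.compAlternatingMap (exteriorPower.ιMulti ℝ (k + 1))) :=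
    exteriorPower.linearMap_ext (by simp)
  have h2 : G' = exteriorPower.alternatingMapLinearEquiv
      ((G.compAlternatingMap (exteriorPower.ιMulti ℝ (k + 1))).curryLeft x) :=
    exteriorPower.linearMap_ext (by
      rw [exteriorPower.alternatingMapLinearEquiv_comp_ιMulti]
      ext y
      exact hG y)
  have := map_lieBoundary_vecCons (G.compAlternatingMap (exteriorPower.ιMulti ℝ (k + 1))) x z
  rwa [← h1, ← h2] at this

theorem exteriorPower_induction {k : ℕ} {P : ⋀[ℝ]^k 𝔤 → Prop}
    (hι : ∀ z, P (exteriorPower.ιMulti ℝ k z)) (hadd : ∀ p q, P p → P q → P (p + q))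
    (hsmul : ∀ (c : ℝ) p, P p → P (c • p)) (p : ⋀[ℝ]^k 𝔤) : P p := by
  have hp : p ∈ Submodule.span ℝ (Set.range (exteriorPower.ιMulti ℝ k (M := 𝔤))) := by
    rw [exteriorPower.ιMulti_span]
    trivial
  induction hp using Submodule.span_induction with
  | mem _ h => obtain ⟨z, rfl⟩ := h; exact hι z
  | zero => simpa using hsmul 0 _ (hι 0)
  | add _ _ _ _ h₁ h₂ => exact hadd _ _ h₁ h₂
  | smul c _ _ h => exact hsmul c _ h

end Homology

/-- Sign bookkeeping for the induction step of the transgression formula: `a` is the contraction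
with ad_x z and `b` is ι(v_{∂z}) ι_{v_x} η. -/
theorem neg_one_pow_smul_sub {N : Type*} [AddCommGroup N] [Module ℝ N] (k : ℕ) (a b : N) :
    (-1 : ℝ) ^ (k + 1) • (a - (-1 : ℝ) ^ (k + 1) • (-1 : ℝ) ^ k • b) =
      (-1 : ℝ) ^ (k + 1 + 1) • (-b - a) := by
  rcases neg_one_pow_eq_or ℝ k with h | h <;> simp only [pow_succ, h] <;> module

/-! ### Transport of forms along equalities of degrees. -/

section Cast

variable {E : Type*} [NormedAddCommGroup E] [NormedSpace ℝ E]
  {M : Type*} [TopologicalSpace M] [ChartedSpace E M] {k l : ℕ}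

theorem cast_mem_smoothForms (h : k = l) {η : DiffForm E M k} (hη : η ∈ smoothForms E M k) :
    η.cast h ∈ smoothForms E M l := by
  subst h; exact hη

theorem DiffForm.cast_neg (h : k = l) (η : DiffForm E M k) : (-η).cast h = -η.cast h := by
  subst h; rfl

theorem neg_smul_form (c : ℝ) (η : DiffForm E M k) : (-c) • η = -(c • η) := neg_smul c η

theorem neg_one_smul_form (η : DiffForm E M k) : (-1 : ℝ) • η = -η := neg_one_smul ℝ η

theorem IsClosedForm.cast {η : DiffForm E M k} (hc : IsClosedForm η) (h : k = l) :
    IsClosedForm (η.cast h) := by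
  subst h; exact hc

theorem DiffForm.cast_cast {n : ℕ} (h : k = l) (h' : l = n) (η : DiffForm E M k) :
    (η.cast h).cast h' = η.cast (h.trans h') := by
  subst h; subst h'; rfl

variable [IsManifold 𝓘(ℝ, E) ∞ M]

theorem interiorProd_cast (h : k = l) (w : VectorField E M) (η : DiffForm E M (k + 1)) :
    interiorProd w (η.cast (congrArg (· + 1) h)) = (interiorProd w η).cast h := by
  subst h; rfl

end Cast

/-! ### Contractions with multivectors and the transgression formula. -/

section Contraction

variable {E : Type*} [NormedAddCommGroup E] [NormedSpace ℝ E]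
  {M : Type*} [TopologicalSpace M] [ChartedSpace E M] [IsManifold 𝓘(ℝ, E) ∞ M]
  {𝔤 : Type*} [LieRing 𝔤] [LieAlgebra ℝ 𝔤] {k l : ℕ}

theorem interiorProd_add (w : VectorField E M) (η θ : DiffForm E M (k + 1)) :
    interiorProd w (η + θ) = interiorProd w η + interiorProd w θ := rfl

theorem interiorProd_smul (w : VectorField E M) (c : ℝ) (η : DiffForm E M (k + 1)) :
    interiorProd w (c • η) = c • interiorProd w η := rfl

theorem interiorProd_zero (w : VectorField E M) :
    interiorProd w (0 : DiffForm E M (k + 1)) = 0 := rfl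

theorem interiorProd_swap (v w : VectorField E M) (η : DiffForm E M (k + 2)) :
    interiorProd v (interiorProd w η) = -interiorProd w (interiorProd v η) :=
  DiffForm.ext_toModel fun x u ↦
    map_vecCons_swap (η.toModel x).toAlternatingMap (toModelField w x) (toModelField v x) u

namespace InfinitesimalAction

variable (v : InfinitesimalAction E M 𝔤)

/-- The contraction `ι(v_p) η` as a linear map in `p`. -/
def contractionLM (η : DiffForm E M (l + k)) : ⋀[ℝ]^k 𝔤 →ₗ[ℝ] DiffForm E M l where
  toFun p := v.contraction p η
  map_add' p q := funext fun x ↦ by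
    simp only [contraction, map_add]
    rfl
  map_smul' c p := funext fun x ↦ by
    simp only [contraction, map_smul]
    rfl

theorem contractionLM_apply (η : DiffForm E M (l + k)) (p : ⋀[ℝ]^k 𝔤) :
    v.contractionLM η p = v.contraction p η := rfl

theorem toModel_contraction_ιMulti (z : Fin k → 𝔤) (η : DiffForm E M (l + k)) (x : M) :
    (v.contraction (exteriorPower.ιMulti ℝ k z) η).toModel x =
      iterContract (η.toModel x) (v.fieldAt x ∘ z) := by
  change contract (V := E) (η.toModel x)
    (exteriorPower.map k (v.fieldAt x) (exteriorPower.ιMulti ℝ k z)) = _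
  rw [exteriorPower.map_apply_ιMulti, contract,
    exteriorPower.alternatingMapLinearEquiv_apply_ιMulti]
  rfl

theorem contraction_ιMulti_zero (z : Fin 0 → 𝔤) (η : DiffForm E M (l + 0)) :
    v.contraction (exteriorPower.ιMulti ℝ 0 z) η = η :=
  funext fun x ↦ v.toModel_contraction_ιMulti z η x

theorem contraction_ιMulti_vecCons (a : 𝔤) (z : Fin k → 𝔤) (η : DiffForm E M (l + (k + 1))) :
    v.contraction (exteriorPower.ιMulti ℝ (k + 1) (Matrix.vecCons a z)) η =
      v.contraction (exteriorPower.ιMulti ℝ k z)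
        (interiorProd (k := l + k) (v.field a) η) :=
  funext fun x ↦ (v.toModel_contraction_ιMulti _ η x).trans
    (v.toModel_contraction_ιMulti z (interiorProd (k := l + k) (v.field a) η) x).symm

theorem contraction_add_form (p : ⋀[ℝ]^k 𝔤) (η θ : DiffForm E M (l + k)) :
    v.contraction p (η + θ) = v.contraction p η + v.contraction p θ := by
  have h : v.contractionLM (η + θ) = v.contractionLM η + v.contractionLM θ := by
    refine exteriorPower.linearMap_ext
      (AlternatingMap.ext fun z ↦ DiffForm.ext_toModel fun x u ↦ ?_)
    change (v.contraction (exteriorPower.ιMulti ℝ k z) (η + θ)).toModel x u =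
      (v.contraction (exteriorPower.ιMulti ℝ k z) η).toModel x u +
        (v.contraction (exteriorPower.ιMulti ℝ k z) θ).toModel x u
    simp only [toModel_contraction_ιMulti, iterContract_apply]
    rfl
  exact DFunLike.congr_fun h p

theorem contraction_smul_form (p : ⋀[ℝ]^k 𝔤) (c : ℝ) (η : DiffForm E M (l + k)) :
    v.contraction p (c • η) = c • v.contraction p η := by
  have h : v.contractionLM (c • η) = c • v.contractionLM η := by
    refine exteriorPower.linearMap_ext
      (AlternatingMap.ext fun z ↦ DiffForm.ext_toModel fun x u ↦ ?_)
    change (v.contraction (exteriorPower.ιMulti ℝ k z) (c • η)).toModel x u =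
      c • (v.contraction (exteriorPower.ιMulti ℝ k z) η).toModel x u
    simp only [toModel_contraction_ιMulti, iterContract_apply]
    rfl
  exact DFunLike.congr_fun h p

theorem contraction_neg_form (p : ⋀[ℝ]^k 𝔤) (η : DiffForm E M (l + k)) :
    v.contraction p (-η) = -v.contraction p η := by
  rw [← neg_one_smul_form η, contraction_smul_form, neg_one_smul_form]

theorem contraction_zero_form (p : ⋀[ℝ]^k 𝔤) :
    v.contraction p (0 : DiffForm E M (l + k)) = 0 := by
  have := v.contraction_smul_form p 0 (0 : DiffForm E M (l + k))
  rwa [zero_smul, zero_smul] at this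

theorem contraction_ιMulti_mem_smoothForms (z : Fin k → 𝔤) {η : DiffForm E M (l + k)}
    (hη : η ∈ smoothForms E M (l + k)) :
    v.contraction (exteriorPower.ιMulti ℝ k z) η ∈ smoothForms E M l := by
  induction k with
  | zero => rwa [contraction_ιMulti_zero]
  | succ k ih =>
    rw [← Matrix.cons_head_tail z, contraction_ιMulti_vecCons]
    exact ih _ (interiorProd_mem_smoothForms (k := l + k) _ hη)

theorem contraction_mem_smoothForms (p : ⋀[ℝ]^k 𝔤) {η : DiffForm E M (l + k)}
    (hη : η ∈ smoothForms E M (l + k)) : v.contraction p η ∈ smoothForms E M l := by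
  simp only [← contractionLM_apply]
  induction p using exteriorPower_induction with
  | hι z => exact v.contraction_ιMulti_mem_smoothForms z hη
  | hadd p q hp hq => rw [map_add]; exact add_mem hp hq
  | hsmul c p hp => rw [map_smul]; exact Submodule.smul_mem _ c hp

/-- Interior products anticommute, so `w` picks up one sign for each of the `k` factors it passes.
-/
theorem interiorProd_contraction_ιMulti (w : VectorField E M) (z : Fin k → 𝔤)
    (η : DiffForm E M (l + 1 + k)) :
    interiorProd w (v.contraction (exteriorPower.ιMulti ℝ k z) η) =
      (-1 : ℝ) ^ k • v.contraction (exteriorPower.ιMulti ℝ k z)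
        (interiorProd w (η.cast (Nat.add_right_comm l 1 k))) := by
  induction k with
  | zero =>
    rw [contraction_ιMulti_zero, contraction_ιMulti_zero, pow_zero, one_smul]
    rfl
  | succ k ih =>
    rw [← Matrix.cons_head_tail z, contraction_ιMulti_vecCons, contraction_ιMulti_vecCons, ih,
      ← interiorProd_cast (Nat.add_right_comm l 1 k), interiorProd_swap, contraction_neg_form,
      pow_succ, mul_neg_one, neg_smul_form, smul_neg]

theorem interiorProd_contraction (w : VectorField E M) (p : ⋀[ℝ]^k 𝔤)
    (η : DiffForm E M (l + 1 + k)) :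
    interiorProd w (v.contraction p η) =
      (-1 : ℝ) ^ k • v.contraction p
        (interiorProd w (η.cast (Nat.add_right_comm l 1 k))) := by
  simp only [← contractionLM_apply]
  induction p using exteriorPower_induction with
  | hι z => exact v.interiorProd_contraction_ιMulti w z η
  | hadd p q hp hq => rw [map_add, map_add, interiorProd_add, hp, hq, smul_add]
  | hsmul c p hp => rw [map_smul, map_smul, interiorProd_smul, hp, smul_comm]

/-- The Lie derivative acts as a derivation on the contraction: each commutator of L_{v_x} with a
contraction by v_{z_j} is a contraction by [v_x, v_{z_j}] = v_{[x, z_j]}. -/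
theorem lieDerivative_contraction_ιMulti (x : 𝔤) (z : Fin k → 𝔤) {η : DiffForm E M (l + k)}
    (hη : η ∈ smoothForms E M (l + k)) :
    lieDerivative (v.field x) (v.contraction (exteriorPower.ιMulti ℝ k z) η) =
      (∑ j, v.contraction (exteriorPower.ιMulti ℝ k (Function.update z j ⁅x, z j⁆)) η) +
        v.contraction (exteriorPower.ιMulti ℝ k z) (lieDerivative (v.field x) η) := by
  induction k with
  | zero => simp [contraction_ιMulti_zero]
  | succ k ih =>
    obtain ⟨a, z, rfl⟩ : ∃ a z', z = Matrix.vecCons a z' :=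
      ⟨_, _, (Matrix.cons_head_tail z).symm⟩
    have h1 (i : Fin k) (b : 𝔤) : Function.update (Matrix.vecCons a z) i.succ b =
        Matrix.vecCons a (Function.update z i b) :=
      (Fin.cons_update (α := fun _ ↦ 𝔤) a z i b).symm
    have h0 (b : 𝔤) : Function.update (Matrix.vecCons a z) 0 b = Matrix.vecCons b z :=
      Fin.update_cons_zero (α := fun _ ↦ 𝔤) a z b
    simp only [Fin.sum_univ_succ, h0, h1, Matrix.cons_val_zero, Matrix.cons_val_succ,
      contraction_ιMulti_vecCons]
    rw [ih _ (interiorProd_mem_smoothForms (k := l + k) _ hη),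
      lieDerivative_interiorProd (k := l + k) (v.field x) (v.field a) (v.field ⁅x, a⁆)
        (v.field_lie x a) hη, contraction_add_form]
    abel

theorem contraction_lieBoundary_vecCons (x : 𝔤) (z : Fin (k + 1) → 𝔤)
    (η : DiffForm E M (l + (k + 1))) :
    v.contraction (lieBoundary 𝔤 (k + 1)
        (exteriorPower.ιMulti ℝ (k + 2) (Matrix.vecCons x z))) η =
      -v.contraction (lieBoundary 𝔤 k (exteriorPower.ιMulti ℝ (k + 1) z))
          (interiorProd (k := l + k) (v.field x) η) -
        ∑ j, v.contraction
          (exteriorPower.ιMulti ℝ (k + 1) (Function.update z j ⁅x, z j⁆)) η :=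
  linearMap_lieBoundary_vecCons (v.contractionLM η)
    (v.contractionLM (interiorProd (k := l + k) (v.field x) η)) x
    (fun y ↦ (v.contraction_ιMulti_vecCons x y η).symm) z

theorem extD_interiorProd (w : VectorField E M) (η : DiffForm E M (k + 1)) :
    extD (interiorProd w η) = lieDerivative w η - interiorProd w (extD η) :=
  (add_sub_cancel_right _ _).symm

variable {v}

theorem IsMultisymplectic.lieDerivative_contraction {η : DiffForm E M (l + k)}
    (hv : v.IsMultisymplectic η) (hη : η ∈ smoothForms E M (l + k)) (x : 𝔤) (z : Fin k → 𝔤) :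
    lieDerivative (v.field x) (v.contraction (exteriorPower.ιMulti ℝ k z) η) =
      ∑ j, v.contraction (exteriorPower.ιMulti ℝ k (Function.update z j ⁅x, z j⁆)) η := by
  rw [lieDerivative_contraction_ιMulti v x z hη, hv x, contraction_zero_form, add_zero]

theorem IsMultisymplectic.cast {η : DiffForm E M k} (hv : v.IsMultisymplectic η) (h : k = l) :
    v.IsMultisymplectic (η.cast h) := by
  subst h; exact hv

/-- `d ι(v_q) η = (-1)^{k+1} ι(v_{∂q}) η` for a closed invariant form `η` and decomposable `q`. -/
theorem extD_contraction_ιMulti {η : DiffForm E M (l + (k + 1))}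
    (hη : η ∈ smoothForms E M (l + (k + 1))) (hc : IsClosedForm η) (hv : v.IsMultisymplectic η)
    (z : Fin (k + 1) → 𝔤) :
    extD (v.contraction (exteriorPower.ιMulti ℝ (k + 1) z) η) =
      (-1 : ℝ) ^ (k + 1) • v.contraction (lieBoundary 𝔤 k (exteriorPower.ιMulti ℝ (k + 1) z))
        (η.cast (show l + (k + 1) = l + 1 + k by omega)) := by
  induction k generalizing l with
  | zero =>
    rw [← Matrix.cons_head_tail z, contraction_ιMulti_vecCons, contraction_ιMulti_zero]
    -- Here ∂₁ = 0, and d ι_{v_x} η = L_{v_x} η - ι_{v_x} dη vanishes because `η` is invariant and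
    -- closed.
    refine (extD_interiorProd (k := l) _ η).trans ?_
    have h1 : lieDerivative (k := l + 1) (v.field (Matrix.vecHead z)) η = 0 := hv _
    have h2 : extD (k := l + 1) η = 0 := hc
    rw [h1, h2, interiorProd_zero, sub_zero, lieBoundary, LinearMap.zero_apply,
      ← contractionLM_apply, map_zero, smul_zero]
  | succ k ih =>
    obtain ⟨x, z, rfl⟩ : ∃ a z', z = Matrix.vecCons a z' :=
      ⟨_, _, (Matrix.cons_head_tail z).symm⟩
    -- The same form with its degree split as (l+1) + (k+1): contracting with the factors of `z`
    -- alone leaves an (l+1)-form, to which Cartan's formula for v_x and the induction hypothesis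
    -- apply.
    set η' := η.cast (show l + (k + 1 + 1) = l + 1 + (k + 1) by omega) with hη'
    have hs' : η' ∈ smoothForms E M (l + 1 + (k + 1)) := cast_mem_smoothForms _ hη
    have hη'' : η = η'.cast (Nat.add_right_comm l 1 (k + 1)) := by rw [hη', DiffForm.cast_cast]; rfl
    have hI := v.interiorProd_contraction_ιMulti (v.field x) z η'
    rw [← hη''] at hI
    -- Moving v_x to the outside turns d of the contraction into d ι_{v_x}, that is, into L_{v_x} -
    -- ι_{v_x} d.
    have hI' : v.contraction (exteriorPower.ιMulti ℝ (k + 1) z)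
        (interiorProd (k := l + (k + 1)) (v.field x) η) = (-1 : ℝ) ^ (k + 1) •
          interiorProd (v.field x) (v.contraction (exteriorPower.ιMulti ℝ (k + 1) z) η') := by
      rw [hI, smul_smul, ← mul_pow]
      simp
    rw [contraction_ιMulti_vecCons, hI', extD_smul, extD_interiorProd,
      (hv.cast _).lieDerivative_contraction hs', ih hs' (hc.cast _) (hv.cast _), interiorProd_smul,
      interiorProd_contraction, contraction_lieBoundary_vecCons, DiffForm.cast_cast]
    exact neg_one_pow_smul_sub k _ _

theorem extD_contraction {η : DiffForm E M (l + (k + 1))}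
    (hη : η ∈ smoothForms E M (l + (k + 1))) (hc : IsClosedForm η) (hv : v.IsMultisymplectic η)
    (q : ⋀[ℝ]^(k + 1) 𝔤) :
    extD (v.contraction q η) = (-1 : ℝ) ^ (k + 1) • v.contraction (lieBoundary 𝔤 k q)
      (η.cast (show l + (k + 1) = l + 1 + k by omega)) := by
  simp only [← contractionLM_apply]
  induction q using exteriorPower_induction with
  | hι z => exact extD_contraction_ιMulti hη hc hv z
  | hadd p q hp hq =>
    have hs (p : ⋀[ℝ]^(k + 1) 𝔤) : v.contractionLM η p ∈ smoothForms E M l :=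
      v.contraction_mem_smoothForms p hη
    rw [map_add, extD_add (hs p) (hs q), hp, hq, map_add, map_add, smul_add]
  | hsmul c p hp => rw [map_smul, extD_smul, hp, map_smul, map_smul, smul_comm]

/-- The contraction of a closed invariant form with a boundary of the same degree vanishes. -/
theorem contraction_lieBoundary_eq_zero {η : DiffForm E M (0 + (k + 1))}
    (hη : η ∈ smoothForms E M (0 + (k + 1))) (hc : IsClosedForm η) (hv : v.IsMultisymplectic η)
    (q : ⋀[ℝ]^(k + 2) 𝔤) : v.contraction (lieBoundary 𝔤 (k + 1) q) η = 0 := by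
  simp only [← contractionLM_apply]
  induction q using exteriorPower_induction with
  | hι z =>
    obtain ⟨x, z, rfl⟩ : ∃ a z', z = Matrix.vecCons a z' :=
      ⟨_, _, (Matrix.cons_head_tail z).symm⟩
    -- On functions L_{v_x} = ι_{v_x} d. The left side expands to the contraction with ad_x z, the
    -- right side by the transgression formula to -ι(v_{∂z}) ι_{v_x} η; the recursion for ∂(x∧z)
    -- makes them cancel.
    have h : lieDerivative (v.field x) (v.contraction (exteriorPower.ιMulti ℝ (k + 1) z) η) =
      interiorProd (v.field x)
        (extD (v.contraction (exteriorPower.ιMulti ℝ (k + 1) z) η)) := rfl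
    rw [hv.lieDerivative_contraction hη, extD_contraction_ιMulti hη hc hv, interiorProd_smul,
      interiorProd_contraction, DiffForm.cast_cast, smul_smul, ← pow_add,
      Odd.neg_one_pow ⟨k, by ring⟩, neg_one_smul_form] at h
    rw [contractionLM_apply, contraction_lieBoundary_vecCons, h, sub_neg_eq_add]
    exact neg_add_cancel _
  | hadd p q hp hq => rw [map_add, map_add, hp, hq, add_zero]
  | hsmul c p hp => rw [map_smul, map_smul, hp, smul_zero]

end InfinitesimalAction

end Contraction

/-! ### Co-momentum maps on boundaries and Hamiltonian vector fields. -/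

section Conservation

variable {E : Type*} [NormedAddCommGroup E] [NormedSpace ℝ E]
  {M : Type*} [TopologicalSpace M] [ChartedSpace E M] [IsManifold 𝓘(ℝ, E) ∞ M]
  {𝔤 : Type*} [LieRing 𝔤] [LieAlgebra ℝ 𝔤] {m : ℕ}
  {η : DiffForm E M (m + 2)} {v : InfinitesimalAction E M 𝔤}

/-- On boundaries the components of a co-momentum map satisfy `d f_k(p) = ± ι(v_p) η`. -/
theorem LInftyMorphism.extD_component_lieBoundary (f : LInftyMorphism η v)
    (hη : η ∈ smoothForms E M (m + 2)) (hc : IsClosedForm η) (hv : v.IsMultisymplectic η)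
    {k l : ℕ} (hkl : k + l = m + 1) (q : ⋀[ℝ]^(k + 1) 𝔤) :
    extD (f.component k l hkl (lieBoundary 𝔤 k q) : DiffForm E M l) =
      (-(sgn (k + 1) * (-1) ^ (k + 1))) • v.contraction (lieBoundary 𝔤 k q)
        (η.cast (show m + 2 = l + 1 + k by omega)) := by
  have key : extD (-(f.component k l hkl (lieBoundary 𝔤 k q) : DiffForm E M l)) =
      sgn (k + 1) • extD (v.contraction q
        (η.cast (show m + 2 = l + (k + 1) by omega))) := by
    have hs := v.contraction_mem_smoothForms q
      (cast_mem_smoothForms (show m + 2 = l + (k + 1) by omega) hη)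
    -- For `l = 0` the moment equation is the top one, without d f_{n+1}; otherwise that term is d
    -- f_{k+1}(q) and d kills it.
    cases l with
    | zero =>
      obtain rfl : k = m + 1 := by omega
      rw [← extD_smul]
      exact congrArg extD (f.main_top q)
    | succ l =>
      have h := f.main k l (by omega) q
      have hf : (f.component (k + 1) l (by omega) q : DiffForm E M l) ∈ smoothForms E M l :=
        Subtype.property _
      rw [h, extD_add (extD_mem_smoothForms hf) (Submodule.smul_mem _ _ hs), extD_extD hf,
        zero_add, extD_smul]
  rw [v.extD_contraction (cast_mem_smoothForms _ hη) (hc.cast _) (hv.cast _), DiffForm.cast_cast,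
    ← neg_one_smul_form, extD_smul, neg_one_smul_form, smul_smul] at key
  rw [neg_smul_form, ← key, neg_neg]

/-- If the action locally preserves `H`, then it preserves `dH`. -/
theorem InfinitesimalAction.LocallyPreserves.isMultisymplectic_extD {H : DiffForm E M m}
    (hpres : v.LocallyPreserves H) (hH : H ∈ smoothForms E M m) :
    v.IsMultisymplectic (extD H) := fun x ↦ by
  have hd := extD_mem_smoothForms hH
  have h1 : lieDerivative (v.field x) (extD H) = extD (interiorProd (v.field x) (extD H)) := by
    rw [InfinitesimalAction.extD_interiorProd, extD_extD hH, interiorProd_zero, sub_zero]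
  rw [h1]
  have h2 : extD (lieDerivative (v.field x) H) = 0 := hpres x
  -- For a function, L_{v_x} H is already ι_{v_x} dH; in positive degree the extra summand d ι_{v_x}
  -- H is killed by d.
  cases m with
  | zero => exact h2
  | succ m =>
    have h3 : lieDerivative (v.field x) H =
      extD (interiorProd (v.field x) H) + interiorProd (v.field x) (extD H) := rfl
    have hi := interiorProd_mem_smoothForms (v.field x) hH
    rwa [h3, extD_add (extD_mem_smoothForms hi) (interiorProd_mem_smoothForms (v.field x) hd),
      extD_extD hi, zero_add] at h2

/-- The step that trades ω for dH: move v_H past the `k` factors and use ι_{v_H}ω = -dH. -/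
theorem IsHamiltonianVectorField.interiorProd_contraction {H : DiffForm E M m}
    {vH : VectorField E M} (hvH : IsHamiltonianVectorField η H vH) {k l : ℕ}
    (hkl : k + l = m + 1) (p : ⋀[ℝ]^k 𝔤) :
    interiorProd vH (v.contraction p (η.cast (show m + 2 = l + 1 + k by omega))) =
      (-(-1) ^ k : ℝ) •
        v.contraction p ((extD H).cast (show m + 1 = l + k by omega)) := by
  have h : extD H = -interiorProd vH η := hvH
  rw [v.interiorProd_contraction, DiffForm.cast_cast, h, DiffForm.cast_neg,
    ← interiorProd_cast (show m + 1 = l + k by omega), v.contraction_neg_form, neg_smul_form,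
    smul_neg, neg_neg]

end Conservation

end Multisymplectic

end

/-- Here `η` is the closed `(n+1)`-form of a pre-`n`-plectic manifold, with `n = m + 1 ≥ 1`, and
`f.component k l _ : Λ^k 𝔤 → Ω^l(M)`, `l = n - k`, is the `k`-th component of the co-momentum map,
for `1 ≤ k ≤ n`. -/
theorem mainTheorem3
    {E : Type*} [NormedAddCommGroup E] [NormedSpace ℝ E] [FiniteDimensional ℝ E]
    {M : Type*} [TopologicalSpace M] [ChartedSpace E M] [IsManifold 𝓘(ℝ, E) ∞ M]
    {𝔤 : Type*} [LieRing 𝔤] [LieAlgebra ℝ 𝔤] {m : ℕ}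
    (η : Multisymplectic.smoothForms E M (m + 2))
    (hη : Multisymplectic.IsClosedForm (η : Multisymplectic.DiffForm E M (m + 2)))
    (v : Multisymplectic.InfinitesimalAction E M 𝔤)
    (hv : v.IsMultisymplectic (η : Multisymplectic.DiffForm E M (m + 2)))
    (H : Multisymplectic.smoothForms E M m)
    (hH : Multisymplectic.IsHamiltonianForm
      (η : Multisymplectic.DiffForm E M (m + 2)) (H : Multisymplectic.DiffForm E M m))
    (hpres : v.LocallyPreserves (H : Multisymplectic.DiffForm E M m))
    (f : Multisymplectic.CoMomentumMap (η : Multisymplectic.DiffForm E M (m + 2)) v)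
    {k l : ℕ} (hk : 1 ≤ k) (hkl : k + l = m + 1)
    (p : ⋀[ℝ]^k 𝔤) (hp : p ∈ Multisymplectic.boundaries 𝔤 k)
    (vH : Multisymplectic.VectorField E M)
    (hvH : Multisymplectic.IsHamiltonianVectorField
      (η : Multisymplectic.DiffForm E M (m + 2)) (H : Multisymplectic.DiffForm E M m) vH) :
    Multisymplectic.IsGloballyConserved vH
      (f.component k l hkl p : Multisymplectic.DiffForm E M l) := by
  open Multisymplectic in
  obtain ⟨q, rfl⟩ := hp
  have hdH := extD_mem_smoothForms H.2
  have hcdH : IsClosedForm (extD (H : DiffForm E M m)) := extD_extD H.2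
  have hvdH := hpres.isMultisymplectic_extD H.2
  have hf := f.extD_component_lieBoundary η.2 hη hv hkl q
  have hι := congrArg (interiorProd vH) hf
  rw [interiorProd_smul, hvH.interiorProd_contraction hkl] at hι
  cases l with
  -- Top case k = n: exactness of a function means vanishing, and its Lie derivative is just ι_{v_H}
  -- d f_n(p), a multiple of ι(v_{∂q})dH = 0.
  | zero =>
    obtain rfl : k = m + 1 := by omega
    rw [InfinitesimalAction.contraction_lieBoundary_eq_zero (cast_mem_smoothForms _ hdH)
      (hcdH.cast _) (hvdH.cast _), smul_zero, smul_zero] at hι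
    exact hι
  | succ l =>
    have hs := cast_mem_smoothForms (show m + 1 = l + (k + 1) by omega) hdH
    have hd := InfinitesimalAction.extD_contraction hs (hcdH.cast _) (hvdH.cast _) q
    rw [DiffForm.cast_cast] at hd
    -- The transgression formula for dH solved for ι(v_{∂q})dH; the sign is its own inverse.
    have hd' : v.contraction (lieBoundary 𝔤 k q)
        ((extD (H : DiffForm E M m)).cast (show m + 1 = l + 1 + k by omega)) =
        (-1 : ℝ) ^ (k + 1) • extD (v.contraction q
          ((extD (H : DiffForm E M m)).cast (show m + 1 = l + (k + 1) by omega))) := by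
      rw [hd, smul_smul, ← mul_pow, neg_one_mul, neg_neg, one_pow, one_smul]
    have hi := interiorProd_mem_smoothForms vH
      (f.component k (l + 1) hkl (lieBoundary 𝔤 k q)).2
    have hq := v.contraction_mem_smoothForms q hs
    rw [hd', ← extD_smul, ← extD_smul, ← extD_smul] at hι
    -- The primitive θ is ι(v_q)dH times three scalars: one from d f_k(p), one from passing v_H
    -- through v_p and one from the transgression formula. The full primitive of L_{v_H} f_k(p) is
    -- then ι_{v_H} f_k(p) + θ.
    obtain ⟨θ, hθ, hιθ⟩ : ∃ θ ∈ smoothForms E M l, interiorProd vH (extD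
        (f.component k (l + 1) hkl (lieBoundary 𝔤 k q) : DiffForm E M (l + 1))) = extD θ :=
      ⟨_, Submodule.smul_mem _ _ (Submodule.smul_mem _ _ (Submodule.smul_mem _ _ hq)), hι⟩
    refine ⟨_, add_mem hi hθ, ?_⟩
    rw [extD_add hi hθ, ← hιθ]
    rfl
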